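/- There is a continuous function $(v,w,\lambda)\mapsto A_{v,w,\lambda}$ from $(0,\infty)^3$ to $(0,\infty)$ with the following property. Let $v,w,\lambda\in(0,\infty)$, let $n$ be a natural number, and let $\xi_1,\dots,\xi_n$ be independent zero-mean random variables such that $\mathsf{E}\,\xi_1^2+\dots+\mathsf{E}\,\xi_n^2=1$. Put $$\beta_v:=\sum_{j=1}^n\mathsf{E}\,g(\xi_j/v),\qquad g(x):=\min(x^2,|x|^3).$$ Let $\bar\xi_1,\dots,\bar\xi_n$ be any independent random variables, on the same probability space, such that for each $j=1,\dots,n$ one has $\bar\xi_j=\xi_j$ on the event $\{\xi_j\le w\}$ and $-\xi_j\le\bar\xi_j\le w$ on the event $\{\xi_j>w\}$. Put $\bar S:=\bar\xi_1+\dots+\bar\xi_n$. Then for all real numbers $a<b$ and all $i=1,\dots,n$ $$\mathsf{P}(a\le\bar S-\bar\xi_i\le b)\le A_{v,w,\lambda}\,(b-a+\beta_v)\,e^{-\lambda a}.$$ -/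

import Mathlib

open MeasureTheory ProbabilityTheory

noncomputable section

/-- The function `g(x) = x² ∧ |x|³`. -/
def gMin (x : ℝ) : ℝ := min (x ^ 2) (|x| ^ 3)

/-- `β_v = E g(ξ₁ / v) + ⋯ + E g(ξₙ / v)`. -/
def betaV {Ω : Type*} [MeasurableSpace Ω] (P : Measure Ω) {n : ℕ} (ξ : Fin n → Ω → ℝ)
    (v : ℝ) : ℝ :=
  ∑ i, ∫ ω, gMin (ξ i ω / v) ∂P

/-- `η` is a version of `x` cut from above at level `w`: it equals `x` on the event `{x ≤ w}`,
and `-x ≤ η ≤ w` on the event `{x > w}`. -/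
def IsUpperCut {Ω : Type*} (w : ℝ) (x η : Ω → ℝ) : Prop :=
  ∀ ω, (x ω ≤ w → η ω = x ω) ∧ (w < x ω → -x ω ≤ η ω ∧ η ω ≤ w)

end

/-!
The proof is Stein's method in the form of the Chen–Shao concentration inequality, with an
exponential weight. Let `X_j` be the cut variables, let `W` be their sum over all indices but `i`,
and let `f` be the Stein function `steinFn`, which increases with slope at least `e^{l x}` on the
slightly enlarged interval `[a - d, b + d]` and satisfies `0 ≤ f(x) ≤ (b - a + 2 d) e^{l x}`.

On the event `a ≤ W ≤ b`, the quantity `∑ X_j (f(W) - f(W - X_j))` is at least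
`e^{l (W - d)} η` with `η = ∑ |X_j| min(d, |X_j|)`. Its expectation is at most a constant times
`b - a + 2 d`: the `X_j` are bounded above by `w` and have nonpositive means, so `W` has bounded
exponential moments (`integral_exp_mul_sum_le`), and cutting changes the means by at most
`(2 / w) E ξ_j²` (`IsUpperCut.sub_sq_le`, `sum_integral_mul_steinFn_sub_le`). Since `Var η ≤ d²`, replacing `η` by its mean
costs a multiple of `d` only, also under the weight `e^{l W}` (`integral_exp_mul_abs_sub_le`).
Together these give `exp_mul_measureReal_le`.

For `d` of order `β_v + (b - a)` the mean of `η` is at least `1 / 4`, because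
`E |X_j| min(d, |X_j|) ≥ E ξ_j² - (K / d) E g(ξ_j / v)` (`sq_sub_le_abs_mul_min`) and the omitted
variance satisfies `E ξ_i² ≤ 1 / 4 + K β_v` (`sq_le_quarter_add_gMin`). When that `d` exceeds `1`,
the exponential Markov inequality already suffices.
-/

/-! ### The Stein function -/

/-- The Stein function `x ↦ e^{l x} · clamp (x - a + d, 0, b - a + 2 d)`. It is nondecreasing,
vanishes to the left of `a - d`, and its slope on `[a - d, b + d]` is at least `e^{l x}`. -/
noncomputable def steinFn (l a b d x : ℝ) : ℝ :=
  Real.exp (l * x) * max 0 (min (x - a + d) (b - a + 2 * d))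

lemma continuous_steinFn (l a b d : ℝ) : Continuous (steinFn l a b d) := by
  unfold steinFn; fun_prop

lemma steinFn_nonneg (l a b d x : ℝ) : 0 ≤ steinFn l a b d x :=
  mul_nonneg (Real.exp_pos _).le (le_max_left _ _)

lemma steinFn_le {l a b d x : ℝ} (h : 0 ≤ b - a + 2 * d) :
    steinFn l a b d x ≤ (b - a + 2 * d) * Real.exp (l * x) := by
  unfold steinFn
  rw [mul_comm]
  exact mul_le_mul_of_nonneg_right (max_le h (min_le_right _ _)) (Real.exp_pos _).le

lemma steinFn_mono {l a b d : ℝ} (hl : 0 ≤ l) : Monotone (steinFn l a b d) := by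
  intro x y hxy
  unfold steinFn
  gcongr

lemma exp_mul_sub_le_steinFn_sub {l a b d y z : ℝ} (hl : 0 ≤ l) (hy : a - d ≤ y) (hyz : y ≤ z)
    (hz : z ≤ b + d) :
    Real.exp (l * y) * (z - y) ≤ steinFn l a b d z - steinFn l a b d y := by
  have key : ∀ x, a - d ≤ x → x ≤ b + d →
      steinFn l a b d x = Real.exp (l * x) * (x - a + d) := by
    intro x h1 h2
    unfold steinFn
    rw [min_eq_left (by linarith), max_eq_right (by linarith)]
  rw [key z (by linarith) hz, key y hy (by linarith)]
  have h : Real.exp (l * y) ≤ Real.exp (l * z) := by gcongr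
  nlinarith [mul_le_mul_of_nonneg_right h (by linarith : 0 ≤ z - a + d)]

lemma mul_steinFn_sub_nonneg {l a b d : ℝ} (hl : 0 ≤ l) (t x : ℝ) :
    0 ≤ x * (steinFn l a b d t - steinFn l a b d (t - x)) := by
  rcases le_total 0 x with h | h
  · exact mul_nonneg h (sub_nonneg.mpr (steinFn_mono hl (by linarith)))
  · exact mul_nonneg_of_nonpos_of_nonpos h (sub_nonpos.mpr (steinFn_mono hl (by linarith)))

/-- The increment of the Stein function at a point `t` of `[a, b]` is bounded below by moving only
the distance `min d |x|`, which stays inside the interval where the slope is controlled. -/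
lemma exp_mul_abs_mul_min_le_mul_steinFn_sub {l a b d t x : ℝ} (hl : 0 ≤ l) (hd : 0 ≤ d)
    (ha : a ≤ t) (hb : t ≤ b) :
    Real.exp (l * (t - d)) * (|x| * min d |x|)
      ≤ x * (steinFn l a b d t - steinFn l a b d (t - x)) := by
  have hm0 : 0 ≤ min d |x| := le_min hd (abs_nonneg x)
  have hmd : min d |x| ≤ d := min_le_left _ _
  have hmx : min d |x| ≤ |x| := min_le_right _ _
  set m := min d |x|
  rcases le_total 0 x with h | h
  · rw [abs_of_nonneg h] at hmx ⊢
    have h1 := exp_mul_sub_le_steinFn_sub (l := l) (a := a) (b := b) (d := d) (y := t - m) (z := t)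
      hl (by linarith) (by linarith) (by linarith)
    have h2 : steinFn l a b d (t - x) ≤ steinFn l a b d (t - m) := steinFn_mono hl (by linarith)
    have h3 : Real.exp (l * (t - d)) ≤ Real.exp (l * (t - m)) := by gcongr
    have h4 : Real.exp (l * (t - d)) * m ≤ steinFn l a b d t - steinFn l a b d (t - x) := by
      have := mul_le_mul_of_nonneg_right h3 hm0
      rw [sub_sub_cancel] at h1
      linarith
    calc _ = x * (Real.exp (l * (t - d)) * m) := by ring
      _ ≤ _ := mul_le_mul_of_nonneg_left h4 h
  · rw [abs_of_nonpos h] at hmx ⊢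
    have h1 := exp_mul_sub_le_steinFn_sub (l := l) (a := a) (b := b) (d := d) (y := t) (z := t + m)
      hl (by linarith) (by linarith) (by linarith)
    have h2 : steinFn l a b d (t + m) ≤ steinFn l a b d (t - x) := steinFn_mono hl (by linarith)
    have h3 : Real.exp (l * (t - d)) ≤ Real.exp (l * t) := by gcongr; linarith
    have h4 : Real.exp (l * (t - d)) * m ≤ steinFn l a b d (t - x) - steinFn l a b d t := by
      have := mul_le_mul_of_nonneg_right h3 hm0
      rw [add_sub_cancel_left] at h1
      linarith
    calc _ = -x * (Real.exp (l * (t - d)) * m) := by ring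
      _ ≤ -x * (steinFn l a b d (t - x) - steinFn l a b d t) :=
          mul_le_mul_of_nonneg_left h4 (by linarith)
      _ = _ := by ring

/-! ### Exponential moments -/

/-- A one-sided quadratic bound for the exponential: only `y ≤ c` is needed, so that it applies to
random variables bounded from above alone. -/
lemma exp_le_one_add_add_sq_mul_exp {y c : ℝ} (hc : 0 ≤ c) (hy : y ≤ c) :
    Real.exp y ≤ 1 + y + y ^ 2 * Real.exp c := by
  have h1 : Real.exp y - 1 ≤ y * Real.exp y := by
    have h := Real.add_one_le_exp (-y)
    have h2 : Real.exp (-y) * Real.exp y = 1 := by rw [← Real.exp_add]; simp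
    nlinarith [Real.exp_pos y]
  have h3 := Real.add_one_le_exp y
  have hc1 : 1 ≤ Real.exp c := Real.one_le_exp hc
  rcases le_or_gt 0 y with h0 | h0
  · have h4 : Real.exp y ≤ Real.exp c := Real.exp_le_exp.mpr hy
    nlinarith [mul_le_mul_of_nonneg_left h1 h0, mul_le_mul_of_nonneg_left h4 (sq_nonneg y)]
  · nlinarith [mul_le_mul_of_nonneg_left hc1 (sq_nonneg y)]

lemma exp_mul_sum_le {Ω ι : Type*} {X : ι → Ω → ℝ} {w s : ℝ} (hs : 0 ≤ s)
    (hw : ∀ i ω, X i ω ≤ w) (J : Finset ι) (ω : Ω) :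
    Real.exp (s * ∑ j ∈ J, X j ω) ≤ Real.exp (s * (J.card * w)) := by
  gcongr
  calc ∑ j ∈ J, X j ω ≤ ∑ _j ∈ J, w := Finset.sum_le_sum fun j _ => hw j ω
    _ = _ := by simp

section Sums

variable {Ω ι : Type*} [MeasurableSpace Ω] {P : Measure Ω} [IsProbabilityMeasure P]
  {X : ι → Ω → ℝ} {w : ℝ}

lemma integrable_of_forall_mem_Icc {f : Ω → ℝ} (hf : Measurable f) (C : ℝ)
    (h0 : ∀ ω, 0 ≤ f ω) (hC : ∀ ω, f ω ≤ C) : Integrable f P :=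
  Integrable.of_bound hf.aestronglyMeasurable C
    (Filter.Eventually.of_forall fun ω => by rw [Real.norm_of_nonneg (h0 ω)]; exact hC ω)

lemma integrable_exp_mul_sum_of_le {s : ℝ} (hs : 0 ≤ s) (hX : ∀ i, Measurable (X i))
    (hw : ∀ i ω, X i ω ≤ w) (J : Finset ι) :
    Integrable (fun ω => Real.exp (s * ∑ j ∈ J, X j ω)) P :=
  integrable_of_forall_mem_Icc (by fun_prop) _ (fun _ => (Real.exp_pos _).le)
    (fun ω => exp_mul_sum_le hs hw J ω)

/-- Exponential moments of a sum of independent variables that are bounded above by `w` and have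
nonpositive means; no lower bound on the variables enters. -/
lemma integral_exp_mul_sum_le {s : ℝ} (hs : 0 ≤ s) (hw0 : 0 ≤ w) (hX : ∀ i, Measurable (X i))
    (hind : iIndepFun X P) (hw : ∀ i ω, X i ω ≤ w) (hL2 : ∀ i, MemLp (X i) 2 P)
    (hmean : ∀ i, ∫ ω, X i ω ∂P ≤ 0) (J : Finset ι)
    (hvar : ∑ j ∈ J, ∫ ω, (X j ω) ^ 2 ∂P ≤ 1) :
    ∫ ω, Real.exp (s * ∑ j ∈ J, X j ω) ∂P ≤ Real.exp (s ^ 2 * Real.exp (s * w)) := by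
  have h1 : ∫ ω, Real.exp (s * ∑ j ∈ J, X j ω) ∂P = ∏ j ∈ J, mgf (X j) P s := by
    rw [← hind.mgf_sum hX J]
    simp [mgf]
  have h2 : ∀ j ∈ J, mgf (X j) P s ≤
      Real.exp (s ^ 2 * Real.exp (s * w) * ∫ ω, (X j ω) ^ 2 ∂P) := by
    intro j _
    have hi1 : Integrable (X j) P := (hL2 j).integrable (by simp)
    have hi2 : Integrable (fun ω => (X j ω) ^ 2) P := (hL2 j).integrable_sq
    have hb : ∀ ω, Real.exp (s * X j ω)
        ≤ 1 + s * X j ω + s ^ 2 * Real.exp (s * w) * (X j ω) ^ 2 := by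
      intro ω
      have := exp_le_one_add_add_sq_mul_exp (mul_nonneg hs hw0)
        (mul_le_mul_of_nonneg_left (hw j ω) hs)
      linarith [this, show (s * X j ω) ^ 2 * Real.exp (s * w)
        = s ^ 2 * Real.exp (s * w) * (X j ω) ^ 2 by ring]
    calc mgf (X j) P s = ∫ ω, Real.exp (s * X j ω) ∂P := rfl
      _ ≤ ∫ ω, (1 + s * X j ω + s ^ 2 * Real.exp (s * w) * (X j ω) ^ 2) ∂P := by
          refine integral_mono ?_ (by fun_prop) hb
          simpa using integrable_exp_mul_sum_of_le (P := P) hs hX hw {j}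
      _ = 1 + s * ∫ ω, X j ω ∂P + s ^ 2 * Real.exp (s * w) * ∫ ω, (X j ω) ^ 2 ∂P := by
          rw [integral_add (by fun_prop) (by fun_prop), integral_add (by fun_prop) (by fun_prop),
            integral_const_mul, integral_const_mul]
          simp
      _ ≤ 1 + s ^ 2 * Real.exp (s * w) * ∫ ω, (X j ω) ^ 2 ∂P := by
          nlinarith [mul_nonneg hs (neg_nonneg.mpr (hmean j))]
      _ ≤ _ := by linarith [Real.add_one_le_exp (s ^ 2 * Real.exp (s * w) * ∫ ω, (X j ω) ^ 2 ∂P)]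
  rw [h1]
  calc _ ≤ ∏ j ∈ J, Real.exp (s ^ 2 * Real.exp (s * w) * ∫ ω, (X j ω) ^ 2 ∂P) :=
        Finset.prod_le_prod (fun j _ => mgf_nonneg) h2
    _ = Real.exp (s ^ 2 * Real.exp (s * w) * ∑ j ∈ J, ∫ ω, (X j ω) ^ 2 ∂P) := by
        rw [← Real.exp_sum, Finset.mul_sum]
    _ ≤ _ := by
        exact Real.exp_le_exp.mpr (mul_le_of_le_one_right (by positivity) hvar)

end Sums

/-! ### Exponentially weighted concentration -/

section Concentration

variable {Ω ι : Type*} [MeasurableSpace Ω] {P : Measure Ω} [IsProbabilityMeasure P]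
  {X : ι → Ω → ℝ} {w l : ℝ}

lemma steinFn_sum_le {Ω ι : Type*} {X : ι → Ω → ℝ} {w l a b d : ℝ} (hl : 0 ≤ l)
    (hD : 0 ≤ b - a + 2 * d) (hw : ∀ i ω, X i ω ≤ w) (J : Finset ι) (ω : Ω) :
    steinFn l a b d (∑ j ∈ J, X j ω) ≤ (b - a + 2 * d) * Real.exp (l * (J.card * w)) :=
  (steinFn_le hD).trans (mul_le_mul_of_nonneg_left (exp_mul_sum_le hl hw J ω) hD)

lemma integrable_mul_steinFn_sum {a b d : ℝ} (hl : 0 ≤ l) (hD : 0 ≤ b - a + 2 * d)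
    (hX : ∀ i, Measurable (X i)) (hw : ∀ i ω, X i ω ≤ w) (hL2 : ∀ i, MemLp (X i) 2 P)
    (J : Finset ι) (i : ι) :
    Integrable (fun ω => X i ω * steinFn l a b d (∑ j ∈ J, X j ω)) P := by
  refine ((hL2 i).integrable (by simp)).mul_bdd
    (c := (b - a + 2 * d) * Real.exp (l * (J.card * w))) ?_ ?_
  · exact ((continuous_steinFn l a b d).measurable.comp (by fun_prop)).aestronglyMeasurable
  · refine Filter.Eventually.of_forall fun ω => ?_
    rw [Real.norm_of_nonneg (steinFn_nonneg _ _ _ _ _)]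
    exact steinFn_sum_le hl hD hw J ω

lemma sum_erase_eq_sub [DecidableEq ι] {J : Finset ι} {j : ι} (hj : j ∈ J) (f : ι → ℝ) :
    ∑ k ∈ J.erase j, f k = ∑ k ∈ J, f k - f j := by
  rw [← Finset.add_sum_erase J f hj]; ring

/-- Upper bound in Stein's identity for the sum `W` over `J`. The part with `E X_j f(W)` is
controlled through `W ≤ e^{l W} / l`; in the part with `E X_j f(W - X_j)` the factors are
independent, and only the total of the (nonpositive) means enters. -/
lemma sum_integral_mul_steinFn_sub_le [DecidableEq ι] {a b d κ : ℝ} (hl : 0 < l) (hw0 : 0 ≤ w)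
    (hD : 0 ≤ b - a + 2 * d)
    (hX : ∀ i, Measurable (X i)) (hind : iIndepFun X P) (hw : ∀ i ω, X i ω ≤ w)
    (hL2 : ∀ i, MemLp (X i) 2 P) (hmean : ∀ i, ∫ ω, X i ω ∂P ≤ 0) (J : Finset ι)
    (hvar : ∑ j ∈ J, ∫ ω, (X j ω) ^ 2 ∂P ≤ 1) (hκ : ∑ j ∈ J, -∫ ω, X j ω ∂P ≤ κ) :
    ∑ j ∈ J, ∫ ω, X j ω * (steinFn l a b d (∑ k ∈ J, X k ω)
        - steinFn l a b d (∑ k ∈ J, X k ω - X j ω)) ∂P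
      ≤ (b - a + 2 * d) * (Real.exp ((2 * l) ^ 2 * Real.exp (2 * l * w)) / l
          + κ * Real.exp (l ^ 2 * Real.exp (l * w))) := by
  set M₁ := Real.exp (l ^ 2 * Real.exp (l * w))
  set M₂ := Real.exp ((2 * l) ^ 2 * Real.exp (2 * l * w))
  set D := b - a + 2 * d
  set f := steinFn l a b d
  have hfm : Measurable f := (continuous_steinFn l a b d).measurable
  have hint : ∀ (K : Finset ι) j, Integrable (fun ω => X j ω * f (∑ k ∈ K, X k ω)) P :=
    fun K j => integrable_mul_steinFn_sum hl.le hD hX hw hL2 K j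
  -- the leave-one-out terms factor by independence
  have hloo : ∀ j ∈ J, -(∫ ω, X j ω * f (∑ k ∈ J.erase j, X k ω) ∂P)
      ≤ (-∫ ω, X j ω ∂P) * (D * M₁) := by
    intro j hj
    have hi : IndepFun (X j) (fun ω => ∑ k ∈ J.erase j, X k ω) P := by
      have h := (hind.indepFun_finsetSum_of_notMem hX (Finset.notMem_erase j J)).symm
      convert h using 1
      ext ω; simp
    have hfac : ∫ ω, X j ω * f (∑ k ∈ J.erase j, X k ω) ∂P
        = (∫ ω, X j ω ∂P) * ∫ ω, f (∑ k ∈ J.erase j, X k ω) ∂P :=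
      (hi.comp measurable_id hfm).integral_fun_mul_eq_mul_integral
        (hX j).aestronglyMeasurable
        (hfm.comp (by fun_prop)).aestronglyMeasurable
    have hvar' : ∑ k ∈ J.erase j, ∫ ω, (X k ω) ^ 2 ∂P ≤ 1 :=
      (Finset.sum_le_sum_of_subset_of_nonneg (Finset.erase_subset _ _)
        fun k _ _ => integral_nonneg fun ω => sq_nonneg _).trans hvar
    have hf : ∫ ω, f (∑ k ∈ J.erase j, X k ω) ∂P ≤ D * M₁ := by
      calc _ ≤ ∫ ω, D * Real.exp (l * ∑ k ∈ J.erase j, X k ω) ∂P := by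
            refine integral_mono ?_ ?_ fun ω => steinFn_le hD
            · exact integrable_of_forall_mem_Icc (hfm.comp (by fun_prop)) _
                (fun ω => steinFn_nonneg _ _ _ _ _) fun ω => steinFn_sum_le hl.le hD hw _ ω
            · exact (integrable_exp_mul_sum_of_le hl.le hX hw _).const_mul D
        _ ≤ _ := by
            rw [integral_const_mul]
            exact mul_le_mul_of_nonneg_left
              (integral_exp_mul_sum_le hl.le hw0 hX hind hw hL2 hmean _ hvar') hD
    rw [hfac, ← neg_mul]
    exact mul_le_mul_of_nonneg_left hf (neg_nonneg.mpr (hmean j))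
  have hW : ∑ j ∈ J, ∫ ω, X j ω * f (∑ k ∈ J, X k ω) ∂P ≤ D * (M₂ / l) := by
    rw [← integral_finsetSum _ fun j _ => hint J j]
    have hle : ∀ ω, ∑ j ∈ J, X j ω * f (∑ k ∈ J, X k ω)
        ≤ D / l * Real.exp (2 * l * ∑ k ∈ J, X k ω) := by
      intro ω
      rw [← Finset.sum_mul]
      set t := ∑ k ∈ J, X k ω
      have ht : t ≤ Real.exp (l * t) / l := by
        rw [le_div_iff₀ hl]
        linarith [Real.add_one_le_exp (l * t)]
      calc t * f t ≤ Real.exp (l * t) / l * f t :=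
            mul_le_mul_of_nonneg_right ht (steinFn_nonneg _ _ _ _ _)
        _ ≤ Real.exp (l * t) / l * (D * Real.exp (l * t)) :=
            mul_le_mul_of_nonneg_left (steinFn_le hD) (by positivity)
        _ = D / l * Real.exp (2 * l * t) := by
            rw [show 2 * l * t = l * t + l * t by ring, Real.exp_add]; ring
    calc _ ≤ ∫ ω, D / l * Real.exp (2 * l * ∑ k ∈ J, X k ω) ∂P :=
          integral_mono (integrable_finsetSum _ fun j _ => hint J j)
            ((integrable_exp_mul_sum_of_le (by positivity) hX hw _).const_mul _) hle
      _ ≤ D / l * M₂ := by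
          rw [integral_const_mul]
          exact mul_le_mul_of_nonneg_left
            (integral_exp_mul_sum_le (by positivity) hw0 hX hind hw hL2 hmean _ hvar)
            (by positivity)
      _ = _ := by ring
  calc _ = ∑ j ∈ J, (∫ ω, X j ω * f (∑ k ∈ J, X k ω) ∂P
        + -∫ ω, X j ω * f (∑ k ∈ J.erase j, X k ω) ∂P) := by
        refine Finset.sum_congr rfl fun j hj => ?_
        rw [← sub_eq_add_neg, ← integral_sub (hint J j) (hint _ j)]
        simp only [mul_sub, sum_erase_eq_sub hj]
    _ ≤ D * (M₂ / l) + (∑ j ∈ J, -∫ ω, X j ω ∂P) * (D * M₁) := by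
        rw [Finset.sum_add_distrib, Finset.sum_mul]
        exact add_le_add hW (Finset.sum_le_sum hloo)
    _ ≤ D * (M₂ / l) + κ * (D * M₁) := by gcongr
    _ = _ := by ring

/-- Fluctuation of `η = ∑ |X_j| min(d, |X_j|)` around its mean, weighted by `e^{l W}`. Since each
summand is at most `d |X_j|`, the variance of `η` is at most `d²`. -/
lemma integral_exp_mul_abs_sub_le {d : ℝ} (hl : 0 ≤ l) (hw0 : 0 ≤ w) (hd : 0 < d)
    (hX : ∀ i, Measurable (X i)) (hind : iIndepFun X P) (hw : ∀ i ω, X i ω ≤ w)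
    (hL2 : ∀ i, MemLp (X i) 2 P) (hmean : ∀ i, ∫ ω, X i ω ∂P ≤ 0) (J : Finset ι)
    (hvar : ∑ j ∈ J, ∫ ω, (X j ω) ^ 2 ∂P ≤ 1) :
    Integrable (fun ω => Real.exp (l * ∑ j ∈ J, X j ω) * |∑ j ∈ J, |X j ω| * min d |X j ω|
        - ∑ j ∈ J, ∫ ω', |X j ω'| * min d |X j ω'| ∂P|) P ∧
    ∫ ω, Real.exp (l * ∑ j ∈ J, X j ω) * |∑ j ∈ J, |X j ω| * min d |X j ω|
        - ∑ j ∈ J, ∫ ω', |X j ω'| * min d |X j ω'| ∂P| ∂P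
      ≤ d * (Real.exp ((2 * l) ^ 2 * Real.exp (2 * l * w)) + 1) / 2 := by
  set Y : ι → Ω → ℝ := fun j ω => |X j ω| * min d |X j ω| with hY
  have hYm : ∀ j, Measurable (Y j) := fun j => by simp only [hY]; fun_prop
  have hYle : ∀ j ω, |Y j ω| ≤ d * |X j ω| := by
    intro j ω
    have h0 : 0 ≤ min d |X j ω| := le_min hd.le (abs_nonneg _)
    rw [abs_of_nonneg (mul_nonneg (abs_nonneg _) h0), mul_comm]
    exact mul_le_mul_of_nonneg_right (min_le_left _ _) (abs_nonneg _)
  have hYL2 : ∀ j, MemLp (Y j) 2 P := fun j =>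
    ((hL2 j).const_mul d).of_le (hYm j).aestronglyMeasurable
      (Filter.Eventually.of_forall fun ω => by
        simpa [abs_mul, abs_of_pos hd] using hYle j ω)
  have hYind : iIndepFun Y P :=
    hind.comp (fun _ x => |x| * min d |x|) fun _ => by fun_prop
  have hvarY : ∀ j, variance (Y j) P ≤ d ^ 2 * ∫ ω, (X j ω) ^ 2 ∂P := by
    intro j
    refine (variance_le_expectation_sq (hYm j).aestronglyMeasurable).trans ?_
    rw [← integral_const_mul]
    refine integral_mono (hYL2 j).integrable_sq ((hL2 j).integrable_sq.const_mul _) fun ω => ?_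
    have := pow_le_pow_left₀ (abs_nonneg _) (hYle j ω) 2
    simpa [mul_pow] using this
  set m := ∑ j ∈ J, ∫ ω', Y j ω' ∂P with hm
  have hvarS : ∫ ω, (∑ j ∈ J, Y j ω - m) ^ 2 ∂P ≤ d ^ 2 := by
    have h1 := IndepFun.variance_sum (s := J) (fun j _ => hYL2 j)
      (fun i _ j _ hij => hYind.indepFun hij)
    rw [variance_eq_integral (by fun_prop)] at h1
    have h2 : ∫ ω, (∑ j ∈ J, Y j) ω ∂P = m := by
      simp only [Finset.sum_apply]
      exact integral_finsetSum _ fun j _ => (hYL2 j).integrable (by simp)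
    rw [h2] at h1
    simp only [Finset.sum_apply] at h1
    rw [h1]
    calc _ ≤ ∑ j ∈ J, d ^ 2 * ∫ ω, (X j ω) ^ 2 ∂P := Finset.sum_le_sum fun j _ => hvarY j
      _ ≤ d ^ 2 := by
        rw [← Finset.mul_sum]
        exact mul_le_of_le_one_right (by positivity) hvar
  have hSL2 : MemLp (fun ω => ∑ j ∈ J, Y j ω - m) 2 P :=
    (memLp_finsetSum J fun j _ => hYL2 j).sub (memLp_const m)
  have hdom : ∀ ω, Real.exp (l * ∑ j ∈ J, X j ω) * |∑ j ∈ J, Y j ω - m|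
      ≤ d / 2 * Real.exp (2 * l * ∑ j ∈ J, X j ω) + 1 / (2 * d) * (∑ j ∈ J, Y j ω - m) ^ 2 := by
    intro ω
    set u := Real.exp (l * ∑ j ∈ J, X j ω) with hu
    have hu2 : Real.exp (2 * l * ∑ j ∈ J, X j ω) = u ^ 2 := by
      rw [hu, sq, ← Real.exp_add]; ring_nf
    rw [hu2, ← sq_abs (∑ j ∈ J, Y j ω - m)]
    set s := |∑ j ∈ J, Y j ω - m|
    have : d / 2 * u ^ 2 + 1 / (2 * d) * s ^ 2 - u * s = (d * u - s) ^ 2 / (2 * d) := by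
      field_simp; ring
    have h0 : 0 ≤ (d * u - s) ^ 2 / (2 * d) := by positivity
    linarith
  have hi2 : Integrable (fun ω => d / 2 * Real.exp (2 * l * ∑ j ∈ J, X j ω)
      + 1 / (2 * d) * (∑ j ∈ J, Y j ω - m) ^ 2) P :=
    ((integrable_exp_mul_sum_of_le (by positivity) hX hw _).const_mul _).add
      (hSL2.integrable_sq.const_mul _)
  have hi1 : Integrable (fun ω => Real.exp (l * ∑ j ∈ J, X j ω) * |∑ j ∈ J, Y j ω - m|) P := by
    refine hi2.mono' (Measurable.aestronglyMeasurable (by fun_prop))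
      (Filter.Eventually.of_forall fun ω => ?_)
    rw [Real.norm_of_nonneg (by positivity)]
    exact hdom ω
  refine ⟨hi1, ?_⟩
  calc _ ≤ ∫ ω, (d / 2 * Real.exp (2 * l * ∑ j ∈ J, X j ω)
      + 1 / (2 * d) * (∑ j ∈ J, Y j ω - m) ^ 2) ∂P := integral_mono hi1 hi2 hdom
    _ = d / 2 * ∫ ω, Real.exp (2 * l * ∑ j ∈ J, X j ω) ∂P
        + 1 / (2 * d) * ∫ ω, (∑ j ∈ J, Y j ω - m) ^ 2 ∂P := by
        rw [integral_add
          ((integrable_exp_mul_sum_of_le (by positivity) hX hw _).const_mul _)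
          (hSL2.integrable_sq.const_mul _), integral_const_mul, integral_const_mul]
    _ ≤ d / 2 * Real.exp ((2 * l) ^ 2 * Real.exp (2 * l * w)) + 1 / (2 * d) * d ^ 2 := by
        gcongr
        exact integral_exp_mul_sum_le (by positivity) hw0 hX hind hw hL2 hmean _ hvar
    _ = _ := by field_simp

/-- Exponentially weighted concentration inequality for a sum `W` of independent variables with
nonpositive means, bounded above by `w`. -/
lemma exp_mul_measureReal_le [DecidableEq ι] {a b d κ : ℝ} (hl : 0 < l) (hw0 : 0 ≤ w)
    (hd : 0 < d) (hab : a ≤ b) (hX : ∀ i, Measurable (X i)) (hind : iIndepFun X P)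
    (hw : ∀ i ω, X i ω ≤ w) (hL2 : ∀ i, MemLp (X i) 2 P) (hmean : ∀ i, ∫ ω, X i ω ∂P ≤ 0)
    (J : Finset ι) (hvar : ∑ j ∈ J, ∫ ω, (X j ω) ^ 2 ∂P ≤ 1)
    (hκ : ∑ j ∈ J, -∫ ω, X j ω ∂P ≤ κ) :
    (∑ j ∈ J, ∫ ω, |X j ω| * min d |X j ω| ∂P) * Real.exp (l * a)
        * P.real {ω | a ≤ ∑ j ∈ J, X j ω ∧ ∑ j ∈ J, X j ω ≤ b}
      ≤ Real.exp (l * d) * ((b - a + 2 * d)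
          * (Real.exp ((2 * l) ^ 2 * Real.exp (2 * l * w)) / l
            + κ * Real.exp (l ^ 2 * Real.exp (l * w))))
        + d * (Real.exp ((2 * l) ^ 2 * Real.exp (2 * l * w)) + 1) / 2 := by
  have hD : 0 ≤ b - a + 2 * d := by linarith
  obtain ⟨hi1, hfl⟩ := integral_exp_mul_abs_sub_le hl.le hw0 hd hX hind hw hL2 hmean J hvar
  have hst := sum_integral_mul_steinFn_sub_le (a := a) (b := b) (d := d) hl hw0 hD hX hind hw hL2
    hmean J hvar hκ
  set m := ∑ j ∈ J, ∫ ω, |X j ω| * min d |X j ω| ∂P with hm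
  have hm0 : 0 ≤ m := Finset.sum_nonneg fun j _ => integral_nonneg fun ω =>
    mul_nonneg (abs_nonneg _) (le_min hd.le (abs_nonneg _))
  have hi0 : ∀ j ∈ J, Integrable (fun ω => X j ω * (steinFn l a b d (∑ k ∈ J, X k ω)
      - steinFn l a b d (∑ k ∈ J, X k ω - X j ω))) P := by
    intro j hj
    have h := (integrable_mul_steinFn_sum (a := a) (b := b) (d := d) hl.le hD hX hw hL2 J j).sub
      (integrable_mul_steinFn_sum (a := a) (b := b) (d := d) hl.le hD hX hw hL2 (J.erase j) j)
    refine h.congr (Filter.Eventually.of_forall fun ω => ?_)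
    simp only [Pi.sub_apply, mul_sub, sum_erase_eq_sub hj]
  rw [← integral_finsetSum _ hi0] at hst
  have hi0' := integrable_finsetSum J hi0
  have hWm : Measurable fun ω => ∑ j ∈ J, X j ω := by fun_prop
  have hA : MeasurableSet {ω | a ≤ ∑ j ∈ J, X j ω ∧ ∑ j ∈ J, X j ω ≤ b} :=
    (measurableSet_le measurable_const hWm).inter (measurableSet_le hWm measurable_const)
  set A := {ω | a ≤ ∑ j ∈ J, X j ω ∧ ∑ j ∈ J, X j ω ≤ b}
  have hpt : ∀ ω, A.indicator (fun _ => m * Real.exp (l * a)) ω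
      ≤ Real.exp (l * d) * (∑ j ∈ J, X j ω * (steinFn l a b d (∑ k ∈ J, X k ω)
          - steinFn l a b d (∑ k ∈ J, X k ω - X j ω)))
        + Real.exp (l * ∑ j ∈ J, X j ω) * |∑ j ∈ J, |X j ω| * min d |X j ω| - m| := by
    intro ω
    by_cases hω : ω ∈ A
    · rw [Set.indicator_of_mem hω]
      obtain ⟨h1, h2⟩ := hω
      have h3 := Finset.sum_le_sum fun j (_ : j ∈ J) =>
        exp_mul_abs_mul_min_le_mul_steinFn_sub (x := X j ω) hl.le hd.le h1 h2
      rw [← Finset.mul_sum] at h3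
      set t := ∑ k ∈ J, X k ω
      set η := ∑ j ∈ J, |X j ω| * min d |X j ω|
      have h4 := mul_le_mul_of_nonneg_left h3 (Real.exp_pos (l * d)).le
      rw [← mul_assoc, ← Real.exp_add, show l * d + l * (t - d) = l * t by ring] at h4
      have h5 : m - η ≤ |η - m| := by rw [abs_sub_comm]; exact le_abs_self _
      have h6 : Real.exp (l * a) ≤ Real.exp (l * t) := by gcongr
      nlinarith [mul_le_mul_of_nonneg_left h5 (Real.exp_pos (l * t)).le,
        mul_le_mul_of_nonneg_left h6 hm0]
    · rw [Set.indicator_of_notMem hω]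
      have := Finset.sum_nonneg fun j (_ : j ∈ J) =>
        mul_steinFn_sub_nonneg (a := a) (b := b) (d := d) hl.le (∑ k ∈ J, X k ω) (X j ω)
      positivity
  calc _ = ∫ ω, A.indicator (fun _ => m * Real.exp (l * a)) ω ∂P := by
        rw [integral_indicator_const _ hA, smul_eq_mul, mul_comm]
    _ ≤ _ := integral_mono ((integrable_const _).indicator hA) ((hi0'.const_mul _).add hi1) hpt
    _ = _ := by rw [integral_add' (hi0'.const_mul _) hi1, integral_const_mul]
    _ ≤ _ := by gcongr

end Concentration

/-! ### Bounds in terms of `g` -/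

section CubicTruncation

lemma gMin_nonneg (x : ℝ) : 0 ≤ gMin x := le_min (sq_nonneg _) (by positivity)

lemma gMin_div_eq {v : ℝ} (hv : 0 < v) (x : ℝ) :
    gMin (x / v) = min (|x| ^ 2 / v ^ 2) (|x| ^ 3 / v ^ 3) := by
  rw [gMin, abs_div, abs_of_pos hv, div_pow, div_pow, sq_abs]

lemma abs_pow_three_le_mul_gMin {v w x : ℝ} (hv : 0 < v) (hx : |x| ≤ w) :
    |x| ^ 3 ≤ (v ^ 3 + v ^ 2 * w) * gMin (x / v) := by
  have hw : 0 ≤ w := (abs_nonneg x).trans hx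
  rw [gMin_div_eq hv]
  have ht := abs_nonneg x
  rcases min_choice (|x| ^ 2 / v ^ 2) (|x| ^ 3 / v ^ 3) with h | h <;> rw [h]
  · rw [show (v ^ 3 + v ^ 2 * w) * (|x| ^ 2 / v ^ 2) = (v + w) * |x| ^ 2 by field_simp]
    nlinarith [sq_nonneg |x|]
  · rw [show (v ^ 3 + v ^ 2 * w) * (|x| ^ 3 / v ^ 3) = |x| ^ 3 + w * |x| ^ 3 / v by field_simp]
    have : 0 ≤ w * |x| ^ 3 / v := by positivity
    linarith

lemma sq_le_mul_gMin {v w x : ℝ} (hv : 0 < v) (hw : 0 < w) (hx : w ≤ |x|) :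
    x ^ 2 ≤ (v ^ 2 + v ^ 3 / w) * gMin (x / v) := by
  rw [gMin_div_eq hv, ← sq_abs x]
  have ht := abs_nonneg x
  rcases min_choice (|x| ^ 2 / v ^ 2) (|x| ^ 3 / v ^ 3) with h | h <;> rw [h]
  · rw [show (v ^ 2 + v ^ 3 / w) * (|x| ^ 2 / v ^ 2) = |x| ^ 2 + v * |x| ^ 2 / w by field_simp]
    have : 0 ≤ v * |x| ^ 2 / w := by positivity
    linarith
  · rw [show (v ^ 2 + v ^ 3 / w) * (|x| ^ 3 / v ^ 3) = |x| ^ 3 / v + |x| ^ 2 * (|x| / w) by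
      field_simp]
    have h1 : 1 ≤ |x| / w := (one_le_div hw).mpr hx
    have : 0 ≤ |x| ^ 3 / v := by positivity
    nlinarith [sq_nonneg |x|]

/-- A constant through which `g(x / v)` dominates `|x|³` on `{|x| ≤ w}`, `x²` on `{w ≤ |x|}`, and
`x²` on `{1/2 ≤ |x|}`. -/
noncomputable def gMinConst (v w : ℝ) : ℝ := 3 * v ^ 3 + v ^ 2 * w + v ^ 2 + v ^ 3 / w

lemma gMinConst_pos {v w : ℝ} (hv : 0 < v) (hw : 0 < w) : 0 < gMinConst v w := by
  unfold gMinConst; positivity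

lemma sq_le_quarter_add_gMin {v w : ℝ} (hv : 0 < v) (hw : 0 < w) (x : ℝ) :
    x ^ 2 ≤ 1 / 4 + gMinConst v w * gMin (x / v) := by
  have hg := gMin_nonneg (x / v)
  rcases le_total (1 / 2) |x| with h | h
  · refine (sq_le_mul_gMin hv (by norm_num) h).trans ?_
    have h1 : v ^ 2 + v ^ 3 / (1 / 2) ≤ gMinConst v w := by
      have : 0 ≤ v ^ 3 + v ^ 2 * w + v ^ 3 / w := by positivity
      unfold gMinConst; linarith
    nlinarith [mul_le_mul_of_nonneg_right h1 hg]
  · have h1 := mul_nonneg (gMinConst_pos hv hw).le hg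
    rw [← sq_abs]
    nlinarith [abs_nonneg x]

/-- For a value `y` of an upper cut of `x`, truncating one factor of `y²` at `d` costs at most a
multiple of `g(x / v) / d`. -/
lemma sq_sub_le_abs_mul_min {v w d x y : ℝ} (hv : 0 < v) (hw : 0 < w) (hd : 0 < d) (hd1 : d ≤ 1)
    (hxy : x ≤ w → y = x) :
    x ^ 2 - gMinConst v w / d * gMin (x / v) ≤ |y| * min d |y| := by
  have hg := gMin_nonneg (x / v)
  have hr : 0 ≤ |y| * min d |y| := mul_nonneg (abs_nonneg _) (le_min hd.le (abs_nonneg _))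
  have suff : d * x ^ 2 ≤ gMinConst v w * gMin (x / v) →
      x ^ 2 - gMinConst v w / d * gMin (x / v) ≤ |y| * min d |y| := by
    intro h
    have : x ^ 2 ≤ gMinConst v w / d * gMin (x / v) := by
      rw [div_mul_eq_mul_div, le_div_iff₀ hd]; linarith
    linarith
  rcases le_total |x| w with hxw | hxw
  · rw [hxy ((le_abs_self x).trans hxw)] at *
    rcases le_total |x| d with hxd | hxd
    · rw [min_eq_right hxd, abs_mul_abs_self]
      have : 0 ≤ gMinConst v w / d * gMin (x / v) :=
        mul_nonneg (div_nonneg (gMinConst_pos hv hw).le hd.le) hg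
      nlinarith
    · apply suff
      have h1 := abs_pow_three_le_mul_gMin hv hxw
      have h2 : v ^ 3 + v ^ 2 * w ≤ gMinConst v w := by
        have : 0 ≤ 2 * v ^ 3 + v ^ 2 + v ^ 3 / w := by positivity
        unfold gMinConst; linarith
      have h3 : d * x ^ 2 ≤ |x| ^ 3 := by
        rw [← sq_abs x]; nlinarith [sq_nonneg |x|]
      linarith [mul_le_mul_of_nonneg_right h2 hg]
  · apply suff
    have h1 := sq_le_mul_gMin hv hw hxw
    have h2 : v ^ 2 + v ^ 3 / w ≤ gMinConst v w := by
      have : 0 ≤ 3 * v ^ 3 + v ^ 2 * w := by positivity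
      unfold gMinConst; linarith
    nlinarith [mul_le_mul_of_nonneg_right h2 hg, sq_nonneg x]

lemma integrable_gMin_div {Ω : Type*} [MeasurableSpace Ω] {P : Measure Ω} {x : Ω → ℝ} (v : ℝ)
    (hx : Measurable x) (hL2 : MemLp x 2 P) : Integrable (fun ω => gMin (x ω / v)) P := by
  have h : Integrable (fun ω => (x ω / v) ^ 2) P := by
    simpa only [div_pow] using hL2.integrable_sq.div_const (v ^ 2)
  refine h.mono' (Measurable.aestronglyMeasurable (by unfold gMin; fun_prop))
    (Filter.Eventually.of_forall fun ω => ?_)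
  rw [Real.norm_of_nonneg (gMin_nonneg _)]
  exact min_le_left _ _

end CubicTruncation

/-! ### Upper cuts -/

section UpperCut

variable {Ω : Type*} {w : ℝ} {x η : Ω → ℝ}

lemma IsUpperCut.le (h : IsUpperCut w x η) (ω : Ω) : η ω ≤ w := by
  rcases le_or_gt (x ω) w with hx | hx
  · rw [(h ω).1 hx]; exact hx
  · exact ((h ω).2 hx).2

lemma IsUpperCut.le_self (h : IsUpperCut w x η) (ω : Ω) : η ω ≤ x ω := by
  rcases le_or_gt (x ω) w with hx | hx
  · exact ((h ω).1 hx).le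
  · exact ((h ω).2 hx).2.trans hx.le

lemma IsUpperCut.abs_le (hw : 0 < w) (h : IsUpperCut w x η) (ω : Ω) : |η ω| ≤ |x ω| := by
  rcases le_or_gt (x ω) w with hx | hx
  · rw [(h ω).1 hx]
  · obtain ⟨h1, h2⟩ := (h ω).2 hx
    rw [abs_of_pos (hw.trans hx)]
    exact _root_.abs_le.mpr ⟨h1, h2.trans hx.le⟩

lemma IsUpperCut.sub_sq_le (hw : 0 < w) (h : IsUpperCut w x η) (ω : Ω) :
    x ω - 2 / w * (x ω) ^ 2 ≤ η ω := by
  rcases le_or_gt (x ω) w with hx | hx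
  · rw [(h ω).1 hx]
    have : 0 ≤ 2 / w * (x ω) ^ 2 := by positivity
    linarith
  · have h1 := ((h ω).2 hx).1
    have h2 : x ω ≤ (x ω) ^ 2 / w := by rw [le_div_iff₀ hw]; nlinarith
    have h3 : 2 / w * (x ω) ^ 2 = 2 * ((x ω) ^ 2 / w) := by ring
    linarith

end UpperCut

/-! ### The concentration inequality for upper cuts -/

/-- The constant in the concentration inequality, as a function of `(v, w, l)`. -/
noncomputable def concentrationConst (p : ℝ × ℝ × ℝ) : ℝ :=
  4 * (Real.exp p.2.2 * ((8 * gMinConst p.1 p.2.1 + 3)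
      * (Real.exp ((2 * p.2.2) ^ 2 * Real.exp (2 * p.2.2 * p.2.1)) / p.2.2
        + 2 / p.2.1 * Real.exp (p.2.2 ^ 2 * Real.exp (p.2.2 * p.2.1))))
    + (4 * gMinConst p.1 p.2.1 + 1)
      * (Real.exp ((2 * p.2.2) ^ 2 * Real.exp (2 * p.2.2 * p.2.1)) + 1) / 2)
  + (4 * gMinConst p.1 p.2.1 + 1) * Real.exp (p.2.2 ^ 2 * Real.exp (p.2.2 * p.2.1))

lemma concentrationConst_pos {v w l : ℝ} (hv : 0 < v) (hw : 0 < w) (hl : 0 < l) :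
    0 < concentrationConst (v, w, l) := by
  have := gMinConst_pos hv hw
  unfold concentrationConst
  positivity

lemma continuousOn_concentrationConst :
    ContinuousOn concentrationConst {p | 0 < p.1 ∧ 0 < p.2.1 ∧ 0 < p.2.2} := by
  have hw : ∀ p ∈ {p : ℝ × ℝ × ℝ | 0 < p.1 ∧ 0 < p.2.1 ∧ 0 < p.2.2}, p.2.1 ≠ 0 :=
    fun p hp => hp.2.1.ne'
  have hl : ∀ p ∈ {p : ℝ × ℝ × ℝ | 0 < p.1 ∧ 0 < p.2.1 ∧ 0 < p.2.2}, p.2.2 ≠ 0 :=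
    fun p hp => hp.2.2.ne'
  unfold concentrationConst gMinConst
  fun_prop (disch := assumption)

theorem proposition4 :
    ∃ A : ℝ × ℝ × ℝ → ℝ,
      ContinuousOn A {p | 0 < p.1 ∧ 0 < p.2.1 ∧ 0 < p.2.2} ∧
      (∀ v w l : ℝ, 0 < v → 0 < w → 0 < l → 0 < A (v, w, l)) ∧
      ∀ v w l : ℝ, 0 < v → 0 < w → 0 < l →
      ∀ (Ω : Type*) [MeasurableSpace Ω] (P : Measure Ω) [IsProbabilityMeasure P]
        (n : ℕ) (ξ ξbar : Fin n → Ω → ℝ),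
        (∀ i, Measurable (ξ i)) →
        iIndepFun ξ P →
        (∀ i, MemLp (ξ i) 2 P) →
        (∀ i, ∫ ω, ξ i ω ∂P = 0) →
        ∑ i, ∫ ω, (ξ i ω) ^ 2 ∂P = 1 →
        (∀ i, Measurable (ξbar i)) →
        iIndepFun ξbar P →
        (∀ i, IsUpperCut w (ξ i) (ξbar i)) →
        ∀ (a b : ℝ), a < b → ∀ i : Fin n,
          P.real {ω | a ≤ (∑ j, ξbar j ω) - ξbar i ω ∧ (∑ j, ξbar j ω) - ξbar i ω ≤ b}
            ≤ A (v, w, l) * ((b - a + betaV P ξ v) * Real.exp (-l * a)) := by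
  refine ⟨concentrationConst, continuousOn_concentrationConst,
    fun v w l hv hw hl => concentrationConst_pos hv hw hl, ?_⟩
  intro v w l hv hw hl Ω _ P _ n ξ X hξ _ hξL2 hξ0 hξ1 hX hind hcut a b hab i
  have hXw : ∀ j ω, X j ω ≤ w := fun j => (hcut j).le
  have hXL2 : ∀ j, MemLp (X j) 2 P := fun j => (hξL2 j).of_le (hX j).aestronglyMeasurable
    (Filter.Eventually.of_forall fun ω => (hcut j).abs_le hw ω)
  have hξi : ∀ j, Integrable (ξ j) P := fun j => (hξL2 j).integrable (by simp)
  have hXi : ∀ j, Integrable (X j) P := fun j => (hXL2 j).integrable (by simp)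
  have hξsq : ∀ j, Integrable (fun ω => (ξ j ω) ^ 2) P := fun j => (hξL2 j).integrable_sq
  have hg : ∀ j, Integrable (fun ω => gMin (ξ j ω / v)) P :=
    fun j => integrable_gMin_div v (hξ j) (hξL2 j)
  have hXmean : ∀ j, ∫ ω, X j ω ∂P ≤ 0 := fun j =>
    (integral_mono (hXi j) (hξi j) (hcut j).le_self).trans (hξ0 j).le
  set J := Finset.univ.erase i with hJ
  have hsum : ∀ f : Fin n → ℝ, ∑ j, f j - f i = ∑ j ∈ J, f j := fun f =>
    (sum_erase_eq_sub (Finset.mem_univ i) f).symm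
  have hξJ : ∑ j ∈ J, ∫ ω, (ξ j ω) ^ 2 ∂P = 1 - ∫ ω, (ξ i ω) ^ 2 ∂P := by
    rw [← hsum, hξ1]
  have hξi0 : 0 ≤ ∫ ω, (ξ i ω) ^ 2 ∂P := integral_nonneg fun ω => sq_nonneg _
  have hvar : ∑ j ∈ J, ∫ ω, (X j ω) ^ 2 ∂P ≤ 1 := by
    have : ∑ j ∈ J, ∫ ω, (X j ω) ^ 2 ∂P ≤ ∑ j ∈ J, ∫ ω, (ξ j ω) ^ 2 ∂P :=
      Finset.sum_le_sum fun j _ => integral_mono (hXL2 j).integrable_sq (hξsq j)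
        fun ω => sq_le_sq.mpr ((hcut j).abs_le hw ω)
    linarith
  have hκ : ∑ j ∈ J, -∫ ω, X j ω ∂P ≤ 2 / w := by
    have h1 : ∀ j ∈ J, -∫ ω, X j ω ∂P ≤ 2 / w * ∫ ω, (ξ j ω) ^ 2 ∂P := by
      intro j _
      have h := integral_mono ((hξi j).sub ((hξsq j).const_mul (2 / w))) (hXi j)
        ((hcut j).sub_sq_le hw)
      rw [integral_sub' (hξi j) ((hξsq j).const_mul _), integral_const_mul, hξ0 j] at h
      linarith
    refine (Finset.sum_le_sum h1).trans ?_
    rw [← Finset.mul_sum]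
    exact mul_le_of_le_one_right (by positivity) (by linarith)
  set K := gMinConst v w with hK
  have hK0 : 0 < K := gMinConst_pos hv hw
  set β := betaV P ξ v with hβ
  have hg0 : ∀ j, 0 ≤ ∫ ω, gMin (ξ j ω / v) ∂P :=
    fun j => integral_nonneg fun ω => gMin_nonneg _
  have hβ0 : 0 ≤ β := Finset.sum_nonneg fun j _ => hg0 j
  simp only [hsum]
  set p := P.real {ω | a ≤ ∑ j ∈ J, X j ω ∧ ∑ j ∈ J, X j ω ≤ b} with hp
  set M₁ := Real.exp (l ^ 2 * Real.exp (l * w)) with hM₁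
  set M₂ := Real.exp ((2 * l) ^ 2 * Real.exp (2 * l * w)) with hM₂
  have hM₁0 : 0 < M₁ := Real.exp_pos _
  have hM₂0 : 0 < M₂ := Real.exp_pos _
  set E := b - a + β with hE
  have hE0 : 0 < E := by linarith
  have hAval : concentrationConst (v, w, l) =
      4 * (Real.exp l * ((8 * K + 3) * (M₂ / l + 2 / w * M₁)) + (4 * K + 1) * (M₂ + 1) / 2)
        + (4 * K + 1) * M₁ := rfl
  suffices h : Real.exp (l * a) * p ≤ concentrationConst (v, w, l) * E by
    have h1 : p = Real.exp (-l * a) * (Real.exp (l * a) * p) := by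
      rw [← mul_assoc, ← Real.exp_add]; simp
    rw [h1]
    linarith [mul_le_mul_of_nonneg_left h (Real.exp_pos (-l * a)).le]
  rw [hAval, add_mul]
  by_cases hd1 : 4 * K * β + (b - a) ≤ 1
  ·
    -- `d ≥ 4 K β` keeps the truncated variance bounded below; adding `b - a` makes `d` positive
    set d := 4 * K * β + (b - a) with hd
    have hKβ : 0 ≤ K * β := by positivity
    have hd0 : 0 < d := by linarith
    have hm : 1 / 4 ≤ ∑ j ∈ J, ∫ ω, |X j ω| * min d |X j ω| ∂P := by
      have h1 : ∀ j ∈ J, (∫ ω, (ξ j ω) ^ 2 ∂P) - K / d * ∫ ω, gMin (ξ j ω / v) ∂P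
          ≤ ∫ ω, |X j ω| * min d |X j ω| ∂P := by
        intro j _
        rw [← integral_const_mul, ← integral_sub (hξsq j) ((hg j).const_mul _)]
        refine integral_mono ((hξsq j).sub ((hg j).const_mul _)) ?_ fun ω =>
          sq_sub_le_abs_mul_min hv hw hd0 hd1 (hcut j ω).1
        refine (hXL2 j).integrable_sq.mono' (hX j |>.abs.mul
          (measurable_const.min (hX j).abs)).aestronglyMeasurable
          (Filter.Eventually.of_forall fun ω => ?_)
        have h0 : 0 ≤ min d |X j ω| := le_min hd0.le (abs_nonneg _)
        rw [Real.norm_of_nonneg (mul_nonneg (abs_nonneg _) h0), ← sq_abs, sq]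
        exact mul_le_mul_of_nonneg_left (min_le_right _ _) (abs_nonneg _)
      have h2 := Finset.sum_le_sum h1
      rw [Finset.sum_sub_distrib, ← Finset.mul_sum, hξJ] at h2
      have h3 : ∑ j ∈ J, ∫ ω, gMin (ξ j ω / v) ∂P ≤ β :=
        Finset.sum_le_sum_of_subset_of_nonneg (Finset.subset_univ _) fun j _ _ => hg0 j
      have h4 : K / d * ∑ j ∈ J, ∫ ω, gMin (ξ j ω / v) ∂P ≤ 1 / 4 := by
        refine (mul_le_mul_of_nonneg_left h3 (by positivity)).trans ?_
        rw [div_mul_eq_mul_div, div_le_iff₀ hd0]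
        linarith
      have h5 : ∫ ω, (ξ i ω) ^ 2 ∂P ≤ 1 / 4 + K * ∫ ω, gMin (ξ i ω / v) ∂P := by
        have h := integral_mono (hξsq i) ((integrable_const (1 / 4)).add ((hg i).const_mul K))
          fun ω => sq_le_quarter_add_gMin hv hw (ξ i ω)
        rw [integral_add' (integrable_const _) ((hg i).const_mul K), integral_const_mul] at h
        simpa using h
      have h6 : ∫ ω, gMin (ξ i ω / v) ∂P ≤ β :=
        Finset.single_le_sum (f := fun j => ∫ ω, gMin (ξ j ω / v) ∂P) (fun j _ => hg0 j)
          (Finset.mem_univ i)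
      have h7 := mul_le_mul_of_nonneg_left h6 hK0.le
      linarith
    have hmain := exp_mul_measureReal_le (a := a) (b := b) hl hw.le hd0 hab.le hX hind hXw hXL2
      hXmean J hvar hκ
    have hq : 0 ≤ Real.exp (l * a) * p := by positivity
    have hdE : d ≤ (4 * K + 1) * E := by
      rw [hd, hE]; nlinarith [mul_pos hK0 (sub_pos.mpr hab)]
    have hDE : b - a + 2 * d ≤ (8 * K + 3) * E := by
      rw [hE] at hdE ⊢; linarith
    have hed : Real.exp (l * d) ≤ Real.exp l :=
      Real.exp_le_exp.mpr (mul_le_of_le_one_right hl.le hd1)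
    have hC : 0 ≤ M₂ / l + 2 / w * M₁ := by positivity
    have h8 : Real.exp (l * d) * ((b - a + 2 * d) * (M₂ / l + 2 / w * M₁))
        ≤ Real.exp l * ((8 * K + 3) * E * (M₂ / l + 2 / w * M₁)) := by
      have hD0 : 0 ≤ b - a + 2 * d := by linarith
      gcongr
    have h9 : d * (M₂ + 1) / 2 ≤ (4 * K + 1) * E * (M₂ + 1) / 2 := by gcongr
    have h10 := mul_le_mul_of_nonneg_right hm hq
    rw [← mul_assoc] at h10
    have h11 : 0 ≤ (4 * K + 1) * M₁ * E := by positivity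
    linarith
  ·
    -- here `E` is bounded below, and the exponential Markov inequality suffices
    have h1 : 1 ≤ (4 * K + 1) * E := by
      push Not at hd1
      rw [hE]; nlinarith [mul_pos hK0 (sub_pos.mpr hab)]
    have h2 : Real.exp (l * a) * p ≤ M₁ := by
      have h := mul_meas_ge_le_integral_of_nonneg
        (Filter.Eventually.of_forall fun ω => (Real.exp_pos (l * ∑ j ∈ J, X j ω)).le)
        (integrable_exp_mul_sum_of_le (P := P) hl.le hX hXw J) (Real.exp (l * a))
      refine le_trans (mul_le_mul_of_nonneg_left (measureReal_mono fun ω hω => ?_)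
        (Real.exp_pos _).le)
        (h.trans (integral_exp_mul_sum_le hl.le hw.le hX hind hXw hXL2 hXmean J hvar))
      exact Real.exp_le_exp.mpr (mul_le_mul_of_nonneg_left hω.1 hl.le)
    have h3 := mul_le_mul_of_nonneg_left h1 hM₁0.le
    have h4 : 0 ≤ 4 * (Real.exp l * ((8 * K + 3) * (M₂ / l + 2 / w * M₁))
        + (4 * K + 1) * (M₂ + 1) / 2) * E := by positivity
    linarith
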